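/- Let $G$ be a finite digraph with vertex set $V$ and edge set $E\neq\emptyset$ (multiple edges are allowed). Assume that $G$ is semi-balanced, i.e. in every cycle of the underlying undirected graph the number of edges oriented in one cyclic direction equals the number of edges oriented in the other. For an edge $e$ with tail $t$ and head $h$ put $\mathbf{x}_e=\mathbf{1}_h-\mathbf{1}_t\in\mathbb{R}^V$; for $S\subseteq E$ let $\mathcal{Q}_S=\mathrm{conv}\{\mathbf{x}_e\mid e\in S\}$, and let $\mathcal{Q}_G=\mathcal{Q}_E$ be the root polytope of $G$. Let $\mathcal{T}$ be a dissecting set of spanning trees for $G$, that is, a set of spanning trees of $G$ (viewed as edge sets; edge directions are ignored in the notion of spanning tree) such that $\bigcup_{T\in\mathcal{T}}\mathcal{Q}_T=\mathcal{Q}_G$ and, for distinct $T,T'\in\mathcal{T}$, the relative interiors of $\mathcal{Q}_T$ and $\mathcal{Q}_{T'}$ are disjoint. Fix any linear ordering of $E$. For a spanning tree $T$ and $e\in T$, let $C^*(T,e)$ be the set of edges of $G$ connecting the two components of $T-e$. The edge $e$ is internally semi-passive for $T$ if the head of the maximal edge of $C^*(T,e)$ and the head of $e$ lie in different components of $T-e$.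 For a $d$-dimensional lattice polytope $P\subset\mathbb{R}^V$, its $h^*$-vector is the unique sequence $(h^*_P)_0,(h^*_P)_1,\dots$ with $(h^*_P)_k=0$ for $k>d$ and $$|t P\cap\mathbb{Z}^V|=\sum_{k=0}^{d}(h^*_P)_k\binom{t+d-k}{d}\qquad\text{for all integers } t\ge 0 .$$ Theorem. The $h^*$-vector of $\mathcal{Q}_G$ exists, and for every integer $i\ge 0$, $$(h^*_{\mathcal{Q}_G})_i=|\{T\in\mathcal{T}\mid T\text{ has exactly } i \text{ internally semi-passive edges}\}|.$$ -/

import Mathlib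

open scoped Pointwise

/-- A directed graph with vertex set `V` and edge set `E`. The edge `e` points from `tail e` to
`head e`. Several edges may have the same tail and the same head; a digraph without multiple edges
is the case where `e ↦ (tail e, head e)` is injective. -/
structure EdgeDigraph (V E : Type*) where
  tail : E → V
  head : E → V

namespace EdgeDigraph

variable {V E : Type*}

/-- `v 0, e 0, v 1, e 1, …, v n, e n, v 0` is a cycle of length `n + 1` of the underlying undirected
graph: the vertices are distinct, the edges are distinct, and `e i` joins `v i` to `v (i + 1)`,
where `i + 1` is taken cyclically in `Fin (n + 1)`. The edge `e i` is directed from `v i` to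
`v (i + 1)` when `fwd i = true`, and from `v (i + 1)` to `v i` when `fwd i = false`. -/
structure IsCycle (G : EdgeDigraph V E) {n : ℕ} (v : Fin (n + 1) → V) (e : Fin (n + 1) → E)
    (fwd : Fin (n + 1) → Bool) : Prop where
  vertex_injective : Function.Injective v
  edge_injective : Function.Injective e
  forward : ∀ i, fwd i = true → G.tail (e i) = v i ∧ G.head (e i) = v (i + 1)
  backward : ∀ i, fwd i = false → G.tail (e i) = v (i + 1) ∧ G.head (e i) = v i

/-- Every cycle has the same number of edges oriented in the two cyclic directions. -/
def IsSemiBalanced (G : EdgeDigraph V E) : Prop :=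
  ∀ (n : ℕ) (v : Fin (n + 1) → V) (e : Fin (n + 1) → E) (fwd : Fin (n + 1) → Bool),
    G.IsCycle v e fwd →
      (Finset.univ.filter fun i => fwd i = true).card =
        (Finset.univ.filter fun i => fwd i = false).card

/-- `u` and `w` lie in the same connected component of the (undirected) spanning subgraph of `G`
with edge set `S`. -/
def Joined (G : EdgeDigraph V E) (S : Set E) (u w : V) : Prop :=
  Relation.EqvGen (fun a b => ∃ e ∈ S, G.tail e = a ∧ G.head e = b) u w

/-- The spanning subgraph with edge set `T` is connected and contains no cycle. -/
structure IsSpanningTree (G : EdgeDigraph V E) (T : Set E) : Prop where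
  nonempty : Nonempty V
  connected : ∀ u w : V, G.Joined T u w
  acyclic : ∀ (n : ℕ) (v : Fin (n + 1) → V) (e : Fin (n + 1) → E) (fwd : Fin (n + 1) → Bool),
    G.IsCycle v e fwd → ¬ ∀ i, e i ∈ T

/-- The fundamental cut `C*(T, e)`: the edges of `G` that connect different components
of `T - e`. -/
def fundamentalCut (G : EdgeDigraph V E) (T : Set E) (e : E) : Set E :=
  {f | ¬ G.Joined (T \ {e}) (G.tail f) (G.head f)}

/-- The heads of `e` and `f` are in the same shore, i.e. in the same component of `T - e`. -/
def StandsParallel (G : EdgeDigraph V E) (T : Set E) (e f : E) : Prop :=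
  G.Joined (T \ {e}) (G.head e) (G.head f)

/-- The maximal edge of the fundamental cut `C*(T, e)` stands opposite to the edge `e` of `T`. -/
def IsInternallySemiPassive [LinearOrder E] (G : EdgeDigraph V E) (T : Set E) (e : E) : Prop :=
  e ∈ T ∧ ∃ f, IsGreatest (G.fundamentalCut T e) f ∧ ¬ G.StandsParallel T e f

/-- The internal semi-passivity of `T`: the number of its internally semi-passive edges. -/
noncomputable def internalSemiPassivity [LinearOrder E] (G : EdgeDigraph V E) (T : Set E) : ℕ :=
  {e | G.IsInternallySemiPassive T e}.ncard

/-- The vector `𝟏_h - 𝟏_t` of the edge `e` with tail `t` and head `h`. -/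
def edgeVector [DecidableEq V] (G : EdgeDigraph V E) (e : E) : V → ℝ :=
  Pi.single (G.head e) 1 - Pi.single (G.tail e) 1

/-- The root polytope of the spanning subgraph of `G` with edge set `S`. -/
def subgraphPolytope [DecidableEq V] (G : EdgeDigraph V E) (S : Set E) : Set (V → ℝ) :=
  convexHull ℝ (G.edgeVector '' S)

/-- The root polytope of `G`. -/
def rootPolytope [DecidableEq V] (G : EdgeDigraph V E) : Set (V → ℝ) :=
  G.subgraphPolytope Set.univ

/-- `𝒯` is a set of spanning trees of `G` whose simplices have pairwise disjoint relative interiors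
and cover the root polytope of `G`. -/
structure IsDissectingTreeSet [DecidableEq V] (G : EdgeDigraph V E) (𝒯 : Set (Set E)) : Prop where
  isSpanningTree : ∀ T ∈ 𝒯, G.IsSpanningTree T
  interior_disjoint : ∀ T₁ ∈ 𝒯, ∀ T₂ ∈ 𝒯, T₁ ≠ T₂ →
    Disjoint (intrinsicInterior ℝ (G.subgraphPolytope T₁))
      (intrinsicInterior ℝ (G.subgraphPolytope T₂))
  cover : ⋃ T ∈ 𝒯, G.subgraphPolytope T = G.rootPolytope

end EdgeDigraph

/-- The number of points of `ℤ^V` in the dilation `t · P`. -/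
noncomputable def latticeCount {V : Type*} (P : Set (V → ℝ)) (t : ℕ) : ℕ :=
  (((t : ℝ) • P) ∩ {x | ∀ u, ∃ z : ℤ, x u = z}).ncard

/-- The dimension of the affine hull of `P`. -/
noncomputable def polytopeDim {V : Type*} (P : Set (V → ℝ)) : ℕ :=
  Module.finrank ℝ (vectorSpan ℝ P)

/-- `a` is the coefficient sequence in the expansion `∑_{k=0}^d a_k * binom(t + d - k, d)` of the
Ehrhart polynomial of the `d`-dimensional lattice polytope `P`, with `a_k = 0` for `k > d`. -/
structure IsHStarVector {V : Type*} (P : Set (V → ℝ)) (a : ℕ → ℚ) : Prop where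
  ehrhart : ∀ t : ℕ, (latticeCount P t : ℚ) =
    ∑ k ∈ Finset.range (polytopeDim P + 1),
      a k * ((t + polytopeDim P - k).choose (polytopeDim P) : ℚ)
  zero_of_lt : ∀ k, polytopeDim P < k → a k = 0

theorem IsHStarVector.unique {V : Type*} {P : Set (V → ℝ)} {a b : ℕ → ℚ}
    (ha : IsHStarVector P a) (hb : IsHStarVector P b) : a = b := by
  funext k
  induction k using Nat.strong_induction_on with
  | _ k ih =>
    by_cases hk : polytopeDim P < k
    · rw [ha.zero_of_lt k hk, hb.zero_of_lt k hk]
    have h := (ha.ehrhart k).symm.trans (hb.ehrhart k)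
    have hmem : k ∈ Finset.range (polytopeDim P + 1) := by
      rw [Finset.mem_range]; omega
    rw [← Finset.add_sum_erase _ _ hmem, ← Finset.add_sum_erase _ _ hmem] at h
    have hs : ∀ j ∈ (Finset.range (polytopeDim P + 1)).erase k,
        a j * ((k + polytopeDim P - j).choose (polytopeDim P) : ℚ) =
          b j * ((k + polytopeDim P - j).choose (polytopeDim P) : ℚ) := by
      intro j hj
      rw [Finset.mem_erase, Finset.mem_range] at hj
      rcases lt_or_gt_of_ne hj.1 with hlt | hgt
      · rw [ih j hlt]
      · rw [Nat.choose_eq_zero_of_lt (by omega)]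
        simp
    rw [Finset.sum_congr rfl hs] at h
    simpa using h

/-- The `h*`-vector of the lattice polytope `P`: the unique sequence with `IsHStarVector P`. -/
noncomputable def hStarVector {V : Type*} (P : Set (V → ℝ)) : ℕ → ℚ :=
  Classical.epsilon (IsHStarVector P)

/-! The proof cuts the dilated polytope into half-open unimodular simplices and counts lattice
points in each.

For a spanning tree `T`, every vector of entry sum zero is a unique combination of the edge vectors
of `T`. Its coefficient at `e` is the sum of its entries over the shore of `T - e` containing the
head of `e`, so integer vectors have integer coefficients. An edge `g` outside the fundamental cut
has coefficient 0; one inside has 1 or -1, according to whether it stands parallel or opposite to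
`e`. Semi-balancedness makes the coefficients of every edge vector sum to 1
(`IsSemiBalanced.sum_coord_edgeVector`), so all edge vectors lie in one affine hyperplane and the
coefficients are barycentric coordinates.

Let `p` be the sum of all edge vectors with weights so rapidly increasing that the largest edge of
each cut decides the sign of the coefficient of `p` there. This sign is negative exactly at the
internally semi-passive edges (`IsSpanningTree.coord_generic`). Moving a point of the dilated
polytope slightly towards `p` puts it over the interior of exactly one simplex of the dissection.
Hence the dilation is partitioned by the simplices with the facets opposite to semi-passive edges
removed (`IsDissectingTreeSet.existsUnique_halfOpenCone`). With `k` such facets removed in dimension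
`d`, stars and bars gives `binom(t + d - k, d)` lattice points; summing over trees gives the
expansion defining the `h*`-vector. -/

namespace EdgeDigraph

variable {V E : Type*}

/-! ### Connectivity, fundamental cycles and potentials -/

section Cycles

variable (G : EdgeDigraph V E)

/-- The simple graph in which distinct vertices are adjacent when an edge of `S` joins them. -/
def toSimpleGraph (S : Set E) : SimpleGraph V :=
  SimpleGraph.fromRel fun a b => ∃ e ∈ S, G.tail e = a ∧ G.head e = b

theorem Joined.reachable {G : EdgeDigraph V E} {S : Set E} {a b : V} (h : G.Joined S a b) :
    (G.toSimpleGraph S).Reachable a b := by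
  induction h with
  | rel x y h =>
    by_cases hxy : x = y
    · rw [hxy]
    · exact SimpleGraph.Adj.reachable ((SimpleGraph.fromRel_adj _ _ _).2 ⟨hxy, Or.inl h⟩)
  | refl x => exact SimpleGraph.Reachable.refl x
  | symm x y _ ih => exact ih.symm
  | trans x y z _ _ ih₁ ih₂ => exact ih₁.trans ih₂

theorem Joined.refl (S : Set E) (a : V) : G.Joined S a a := Relation.EqvGen.refl a

variable {G}

theorem Joined.symm {S : Set E} {a b : V} (h : G.Joined S a b) : G.Joined S b a :=
  Relation.EqvGen.symm _ _ h

theorem Joined.trans {S : Set E} {a b c : V} (h : G.Joined S a b) (h' : G.Joined S b c) :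
    G.Joined S a c := Relation.EqvGen.trans _ _ _ h h'

theorem Joined.of_mem {S : Set E} {e : E} (h : e ∈ S) : G.Joined S (G.tail e) (G.head e) :=
  Relation.EqvGen.rel _ _ ⟨e, h, rfl, rfl⟩

/-- An edge whose ends are joined by other edges closes up to a cycle. -/
theorem exists_isCycle_of_joined {S : Set E} {g : E} (hg : g ∉ S)
    (h : G.Joined S (G.tail g) (G.head g)) :
    ∃ (n : ℕ) (v : Fin (n + 1) → V) (e : Fin (n + 1) → E) (fwd : Fin (n + 1) → Bool),
      G.IsCycle v e fwd ∧ e (Fin.last n) = g ∧ fwd (Fin.last n) = false ∧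
        ∀ i : Fin n, e i.castSucc ∈ S := by
  classical
  obtain ⟨p, hp⟩ := h.reachable.exists_isPath
  set n := p.length with hn
  have hinj : ∀ i j : ℕ, i ≤ n → j ≤ n → p.getVert i = p.getVert j → i = j :=
    fun i j hi hj hij => hp.getVert_injOn hi hj hij
  have hstep : ∀ i : Fin n, ∃ e ∈ S, ∃ b : Bool,
      (b = true → G.tail e = p.getVert i ∧ G.head e = p.getVert (i + 1)) ∧
      (b = false → G.tail e = p.getVert (i + 1) ∧ G.head e = p.getVert i) := by
    intro i
    have hadj := (SimpleGraph.fromRel_adj _ _ _).1 (p.adj_getVert_succ i.2)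
    rcases hadj.2 with ⟨e, he, h₁, h₂⟩ | ⟨e, he, h₁, h₂⟩
    · exact ⟨e, he, true, fun _ => ⟨h₁, h₂⟩, fun h => by simp at h⟩
    · exact ⟨e, he, false, fun h => by simp at h, fun _ => ⟨h₁, h₂⟩⟩
  choose e he b hb₁ hb₂ using hstep
  -- The path runs from the tail of `g` to its head, so `g`, placed last, closes the cycle against
  -- its own direction.
  refine ⟨n, fun i => p.getVert i, Fin.lastCases g e, Fin.lastCases false b,
    ⟨?_, ?_, ?_, ?_⟩, by simp, by simp, by simpa using he⟩
  · intro i j hij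
    exact Fin.ext (hinj _ _ (Nat.lt_succ_iff.1 i.2) (Nat.lt_succ_iff.1 j.2) hij)
  · have key : ∀ i j : Fin n, e i = e j → i = j := by
      intro i j hij
      have hi := i.2
      have hj := j.2
      cases h₁ : b i <;> cases h₂ : b j
      · have := (hb₂ i h₁).2.symm.trans ((congrArg G.head hij).trans (hb₂ j h₂).2)
        exact Fin.ext (hinj _ _ (by omega) (by omega) this)
      · have ha := (hb₂ i h₁).2.symm.trans ((congrArg G.head hij).trans (hb₁ j h₂).2)
        have hb := (hb₂ i h₁).1.symm.trans ((congrArg G.tail hij).trans (hb₁ j h₂).1)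
        have := hinj _ _ (by omega) (by omega) ha
        have := hinj _ _ (by omega) (by omega) hb
        -- Opposite orientations would force both `i = j + 1` and `i + 1 = j`.
        omega
      · have ha := (hb₁ i h₁).2.symm.trans ((congrArg G.head hij).trans (hb₂ j h₂).2)
        have hb := (hb₁ i h₁).1.symm.trans ((congrArg G.tail hij).trans (hb₂ j h₂).1)
        have := hinj _ _ (by omega) (by omega) ha
        have := hinj _ _ (by omega) (by omega) hb
        omega
      · have := (hb₁ i h₁).1.symm.trans ((congrArg G.tail hij).trans (hb₁ j h₂).1)
        exact Fin.ext (hinj _ _ (by omega) (by omega) this)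
    intro i j hij
    induction i using Fin.lastCases with
    | last =>
      induction j using Fin.lastCases with
      | last => rfl
      | cast j =>
        simp only [Fin.lastCases_last, Fin.lastCases_castSucc] at hij
        exact absurd (hij ▸ he j) hg
    | cast i =>
      induction j using Fin.lastCases with
      | last =>
        simp only [Fin.lastCases_last, Fin.lastCases_castSucc] at hij
        exact absurd (hij ▸ he i) hg
      | cast j =>
        simp only [Fin.lastCases_castSucc] at hij
        rw [key i j hij]
  · intro i hi
    induction i using Fin.lastCases with
    | last => simp at hi
    | cast i =>
      simp only [Fin.lastCases_castSucc] at hi ⊢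
      simpa using hb₁ i hi
  · intro i hi
    induction i using Fin.lastCases with
    | last => simp [hn]
    | cast i =>
      simp only [Fin.lastCases_castSucc] at hi ⊢
      simpa using hb₂ i hi

theorem IsSpanningTree.not_joined_diff {T : Set E} (hT : G.IsSpanningTree T) {e : E} (he : e ∈ T) :
    ¬ G.Joined (T \ {e}) (G.tail e) (G.head e) := by
  intro h
  obtain ⟨n, v, c, fwd, hc, hl, -, hS⟩ := exists_isCycle_of_joined (by simp) h
  refine hT.acyclic n v c fwd hc fun i => ?_
  induction i using Fin.lastCases with
  | last => rwa [hl]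
  | cast i => exact (hS i).1

/-- The union of the two shores is closed under every edge of `T`, including `e` itself, and `T` is
connected. -/
theorem IsSpanningTree.joined_head_or_tail {T : Set E} (hT : G.IsSpanningTree T) (e : E)
    (v : V) : G.Joined (T \ {e}) (G.head e) v ∨ G.Joined (T \ {e}) (G.tail e) v := by
  have key : ∀ u w, G.Joined T u w →
      ((G.Joined (T \ {e}) (G.head e) u ∨ G.Joined (T \ {e}) (G.tail e) u) ↔
        (G.Joined (T \ {e}) (G.head e) w ∨ G.Joined (T \ {e}) (G.tail e) w)) := by
    intro u w h
    induction h with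
    | rel x y h =>
      obtain ⟨f, hf, rfl, rfl⟩ := h
      by_cases hfe : f = e
      · subst hfe
        exact ⟨fun _ => Or.inl (Joined.refl _ _ _), fun _ => Or.inr (Joined.refl _ _ _)⟩
      · have hj : G.Joined (T \ {e}) (G.tail f) (G.head f) := Joined.of_mem ⟨hf, hfe⟩
        exact ⟨Or.imp (fun h => h.trans hj) (fun h => h.trans hj),
          Or.imp (fun h => h.trans hj.symm) (fun h => h.trans hj.symm)⟩
    | refl x => rfl
    | symm x y _ ih => exact ih.symm
    | trans x y z _ _ ih₁ ih₂ => exact ih₁.trans ih₂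
  exact (key _ v (hT.connected (G.head e) v)).1 (Or.inl (Joined.refl _ _ _))

/-- A potential that increases by one along the edges of `S` increases by one along every edge
whose ends are joined by `S`. -/
theorem IsSemiBalanced.potential_eq_one (hG : G.IsSemiBalanced) {S : Set E} {φ : V → ℝ}
    (hφ : ∀ e ∈ S, φ (G.head e) - φ (G.tail e) = 1) {g : E}
    (h : G.Joined S (G.tail g) (G.head g)) : φ (G.head g) - φ (G.tail g) = 1 := by
  by_cases hg : g ∈ S
  · exact hφ g hg
  obtain ⟨n, v, e, fwd, hc, hl, hlf, hS⟩ := exists_isCycle_of_joined hg h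
  have hcard := hG n v e fwd hc
  -- Potential differences telescope around the cycle and semi-balancedness cancels the signs; the
  -- two sums agree on all edges but `g`, so they agree on `g` as well.
  have hzero : ∑ i, (φ (v (i + 1)) - φ (v i)) = 0 := by
    rw [Finset.sum_sub_distrib, sub_eq_zero]
    exact Equiv.sum_comp (Equiv.addRight (1 : Fin (n + 1))) fun i => φ (v i)
  have hsign : ∑ i, (if fwd i = true then (1 : ℝ) else -1) = 0 := by
    rw [Finset.sum_ite]
    simp only [Finset.sum_const, nsmul_eq_mul, mul_one, Bool.not_eq_true, hcard]
    ring
  have hterm : ∀ i : Fin n, φ (v (i.castSucc + 1)) - φ (v i.castSucc) =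
      if fwd i.castSucc = true then (1 : ℝ) else -1 := by
    intro i
    have := hφ _ (hS i)
    cases hf : fwd i.castSucc
    · rw [(hc.backward _ hf).1, (hc.backward _ hf).2] at this
      simp only [Bool.false_eq_true, if_false]
      linarith
    · rw [(hc.forward _ hf).1, (hc.forward _ hf).2] at this
      simpa using this
  rw [Fin.sum_univ_castSucc] at hzero hsign
  rw [Finset.sum_congr rfl fun i _ => hterm i] at hzero
  have hb := hc.backward _ hlf
  rw [hl] at hb
  rw [hb.1, hb.2]
  simp only [hlf, Bool.false_eq_true, if_false] at hsign
  linarith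

theorem Joined.single_sub_single_mem_span [DecidableEq V] {S : Set E} {u w : V}
    (h : G.Joined S u w) :
    (Pi.single w 1 - Pi.single u 1 : V → ℝ) ∈ Submodule.span ℝ (G.edgeVector '' S) := by
  induction h with
  | rel x y h =>
    obtain ⟨e, he, rfl, rfl⟩ := h
    exact Submodule.subset_span ⟨e, he, rfl⟩
  | refl x => simp
  | symm x y _ ih => simpa using Submodule.neg_mem _ ih
  | trans x y z _ _ ih₁ ih₂ => simpa using Submodule.add_mem _ ih₂ ih₁

end Cycles

/-! ### Coordinates with respect to a spanning tree -/

section Coordinates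

variable [Fintype V] (G : EdgeDigraph V E)

open Classical in
/-- For an edge `e` of `T`, the sum of the entries over the component of `T - e` that contains the
head of `e`. For a spanning tree `T` this is the coordinate of a vector of entry sum zero with
respect to the edge vector of `e` in the basis given by `T`. -/
noncomputable def coord (T : Set E) (e : E) : (V → ℝ) →ₗ[ℝ] ℝ :=
  if e ∈ T then ∑ v, if G.Joined (T \ {e}) (G.head e) v then LinearMap.proj v else 0 else 0

variable {G}

theorem coord_of_notMem {T : Set E} {e : E} (he : e ∉ T) : G.coord T e = 0 := if_neg he

open Classical in
theorem coord_apply {T : Set E} {e : E} (he : e ∈ T) (x : V → ℝ) :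
    G.coord T e x = ∑ v, if G.Joined (T \ {e}) (G.head e) v then x v else 0 := by
  rw [coord, if_pos he, LinearMap.sum_apply]
  refine Finset.sum_congr rfl fun v _ => ?_
  split_ifs <;> simp

theorem continuous_coord (T : Set E) (e : E) : Continuous (G.coord T e) :=
  LinearMap.continuous_of_finiteDimensional _

/-- This is the unimodularity of the tree simplices: a coordinate is a plain sum of entries. -/
theorem exists_int_coord (T : Set E) (e : E) {x : V → ℝ} (hx : ∀ v, ∃ z : ℤ, x v = z) :
    ∃ z : ℤ, G.coord T e x = z := by
  classical
  by_cases he : e ∈ T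
  · choose z hz using hx
    refine ⟨∑ v, if G.Joined (T \ {e}) (G.head e) v then z v else 0, ?_⟩
    rw [coord_apply he]
    push_cast
    exact Finset.sum_congr rfl fun v _ => by rw [hz v]
  · exact ⟨0, by simp [coord_of_notMem he]⟩

variable [DecidableEq V]

open Classical in
theorem coord_single {T : Set E} {e : E} (he : e ∈ T) (v : V) :
    G.coord T e (Pi.single v 1) = if G.Joined (T \ {e}) (G.head e) v then 1 else 0 := by
  rw [coord_apply he, Finset.sum_eq_single v]
  · simp
  · intro w _ hw
    simp [hw]
  · simp

theorem coord_edgeVector_of_joined {T : Set E} {e g : E}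
    (h : G.Joined (T \ {e}) (G.tail g) (G.head g)) : G.coord T e (G.edgeVector g) = 0 := by
  classical
  by_cases he : e ∈ T
  · rw [edgeVector, map_sub, coord_single he, coord_single he]
    have : G.Joined (T \ {e}) (G.head e) (G.head g) ↔ G.Joined (T \ {e}) (G.head e) (G.tail g) :=
      ⟨fun h' => h'.trans h.symm, fun h' => h'.trans h⟩
    simp [this]
  · simp [coord_of_notMem he]

theorem coord_edgeVector_of_parallel {T : Set E} {e g : E} (he : e ∈ T)
    (h : ¬ G.Joined (T \ {e}) (G.tail g) (G.head g)) (hg : G.StandsParallel T e g) :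
    G.coord T e (G.edgeVector g) = 1 := by
  classical
  rw [StandsParallel] at hg
  rw [edgeVector, map_sub, coord_single he, coord_single he, if_pos hg, if_neg, sub_zero]
  exact fun h' => h (h'.symm.trans hg)

theorem IsSpanningTree.coord_edgeVector_of_not_parallel {T : Set E} (hT : G.IsSpanningTree T)
    {e g : E} (he : e ∈ T) (h : ¬ G.Joined (T \ {e}) (G.tail g) (G.head g))
    (hg : ¬ G.StandsParallel T e g) : G.coord T e (G.edgeVector g) = -1 := by
  classical
  rw [StandsParallel] at hg
  rw [edgeVector, map_sub, coord_single he, coord_single he, if_neg hg, if_pos, zero_sub]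
  refine (hT.joined_head_or_tail e (G.tail g)).resolve_right fun h' => ?_
  exact h (h'.symm.trans ((hT.joined_head_or_tail e (G.head g)).resolve_left hg))

theorem IsSpanningTree.coord_edgeVector_self {T : Set E} (hT : G.IsSpanningTree T)
    {e : E} (he : e ∈ T) : G.coord T e (G.edgeVector e) = 1 :=
  coord_edgeVector_of_parallel he (hT.not_joined_diff he) (Joined.refl _ _ _)

theorem coord_edgeVector_of_ne {T : Set E} {e g : E} (hg : g ∈ T) (hne : g ≠ e) :
    G.coord T e (G.edgeVector g) = 0 :=
  coord_edgeVector_of_joined (Joined.of_mem ⟨hg, hne⟩)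

theorem sum_edgeVector (e : E) : ∑ v, G.edgeVector e v = 0 := by
  simp [edgeVector]

theorem IsSpanningTree.mem_span {T : Set E} (hT : G.IsSpanningTree T) {x : V → ℝ}
    (hx : ∑ v, x v = 0) : x ∈ Submodule.span ℝ (G.edgeVector '' T) := by
  obtain ⟨r⟩ := hT.nonempty
  have : x = ∑ v, x v • (Pi.single v 1 - Pi.single r 1 : V → ℝ) := by
    simp only [smul_sub, Finset.sum_sub_distrib]
    rw [← Finset.sum_smul, hx, zero_smul, sub_zero]
    exact pi_eq_sum_univ' x
  rw [this]
  exact Submodule.sum_mem _ fun v _ =>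
    Submodule.smul_mem _ _ (hT.connected r v).single_sub_single_mem_span

variable [Fintype E]

theorem IsSpanningTree.coord_sum_smul {T : Set E} (hT : G.IsSpanningTree T) {e : E} (he : e ∈ T)
    {c : E → ℝ} (hc : ∀ g, g ∉ T → c g = 0) :
    G.coord T e (∑ g, c g • G.edgeVector g) = c e := by
  rw [map_sum, Finset.sum_eq_single e]
  · rw [map_smul, hT.coord_edgeVector_self he, smul_eq_mul, mul_one]
  · intro g _ hg
    by_cases hgT : g ∈ T
    · rw [map_smul, coord_edgeVector_of_ne hgT hg, smul_zero]
    · rw [hc g hgT, zero_smul, map_zero]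
  · simp

theorem IsSpanningTree.sum_coord_smul {T : Set E} (hT : G.IsSpanningTree T) {x : V → ℝ}
    (hx : ∑ v, x v = 0) : ∑ e, G.coord T e x • G.edgeVector e = x := by
  refine Submodule.span_induction (p := fun x _ => ∑ e, G.coord T e x • G.edgeVector e = x)
    ?_ ?_ ?_ ?_ (hT.mem_span hx)
  · rintro _ ⟨g, hg, rfl⟩
    rw [Finset.sum_eq_single g]
    · rw [hT.coord_edgeVector_self hg, one_smul]
    · intro e _ he
      rw [coord_edgeVector_of_ne hg he.symm, zero_smul]
    · simp
  · simp
  · intro x y _ _ hx hy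
    simp only [map_add, add_smul, Finset.sum_add_distrib, hx, hy]
  · intro a x _ hx
    simp only [map_smul, smul_assoc, ← Finset.smul_sum, hx]

/-- The coordinate sum, evaluated on unit vectors, is a potential rising by one along each edge of
`T`, hence along every edge of `G`. -/
theorem IsSemiBalanced.sum_coord_edgeVector (hG : G.IsSemiBalanced) {T : Set E}
    (hT : G.IsSpanningTree T) (g : E) : ∑ e, G.coord T e (G.edgeVector g) = 1 := by
  have := hG.potential_eq_one (S := T) (φ := fun v => ∑ e, G.coord T e (Pi.single v 1))
    (fun f hf => ?_) (hT.connected (G.tail g) (G.head g))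
  · simpa only [edgeVector, map_sub, Finset.sum_sub_distrib] using this
  · rw [← Finset.sum_sub_distrib, Finset.sum_eq_single f]
    · rw [← map_sub]
      exact hT.coord_edgeVector_self hf
    · intro e _ he
      rw [← map_sub]
      exact coord_edgeVector_of_ne hf he.symm
    · simp

theorem IsSemiBalanced.sum_coord_sum_smul (hG : G.IsSemiBalanced) {T : Set E}
    (hT : G.IsSpanningTree T) (c : E → ℝ) :
    ∑ e, G.coord T e (∑ g, c g • G.edgeVector g) = ∑ g, c g := by
  simp only [map_sum, map_smul, smul_eq_mul]
  rw [Finset.sum_comm]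
  simp only [← Finset.mul_sum, hG.sum_coord_edgeVector hT, mul_one]

theorem sum_sum_smul_edgeVector (c : E → ℝ) : ∑ v, (∑ g, c g • G.edgeVector g) v = 0 := by
  simp only [Finset.sum_apply, Pi.smul_apply, smul_eq_mul]
  rw [Finset.sum_comm]
  simp only [← Finset.mul_sum, sum_edgeVector, mul_zero, Finset.sum_const_zero]

end Coordinates

/-! ### Tree simplices: barycentric coordinates, interior, dimension -/

section Polytopes

variable [DecidableEq V] [Fintype E] {G : EdgeDigraph V E}

theorem mem_subgraphPolytope_iff {S : Set E} {x : V → ℝ} :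
    x ∈ G.subgraphPolytope S ↔ ∃ c : E → ℝ, (∀ e, 0 ≤ c e) ∧ (∀ e, e ∉ S → c e = 0) ∧
      ∑ e, c e = 1 ∧ ∑ e, c e • G.edgeVector e = x := by
  classical
  constructor
  · intro hx
    refine convexHull_min (t := {x | ∃ c : E → ℝ, (∀ e, 0 ≤ c e) ∧ (∀ e, e ∉ S → c e = 0) ∧
      ∑ e, c e = 1 ∧ ∑ e, c e • G.edgeVector e = x}) ?_ ?_ hx
    · rintro _ ⟨g, hg, rfl⟩
      refine ⟨Pi.single g 1, fun e => ?_, fun e he => ?_, by simp, ?_⟩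
      · by_cases h : e = g
        · subst h; simp
        · simp [h]
      · exact Pi.single_eq_of_ne (by rintro rfl; exact he hg) 1
      · rw [Finset.sum_eq_single g] <;> simp +contextual
    · rintro _ ⟨c, hc₀, hcS, hc₁, rfl⟩ _ ⟨d, hd₀, hdS, hd₁, rfl⟩ a b ha hb hab
      refine ⟨fun e => a * c e + b * d e, fun e => ?_, fun e he => ?_, ?_, ?_⟩
      · have := hc₀ e
        have := hd₀ e
        positivity
      · simp [hcS e he, hdS e he]
      · rw [Finset.sum_add_distrib, ← Finset.mul_sum, ← Finset.mul_sum, hc₁, hd₁, mul_one, mul_one,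
          hab]
      · simp only [add_smul, mul_smul, Finset.sum_add_distrib, ← Finset.smul_sum]
  · rintro ⟨c, hc₀, hcS, hc₁, rfl⟩
    have h₁ : ∑ e with e ∈ S, c e = 1 := by
      rw [Finset.sum_filter_of_ne, hc₁]
      exact fun e _ h => by_contra fun he => h (hcS e he)
    have h₂ : ∑ e with e ∈ S, c e • G.edgeVector e = ∑ e, c e • G.edgeVector e := by
      rw [Finset.sum_filter_of_ne]
      exact fun e _ h => by_contra fun he => h (by rw [hcS e he, zero_smul])
    rw [← h₂]
    refine (convex_convexHull ℝ _).sum_mem (fun e _ => hc₀ e) h₁ fun e he => ?_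
    exact subset_convexHull ℝ _ ⟨e, (Finset.mem_filter.1 he).2, rfl⟩

theorem mem_smul_subgraphPolytope_iff {S : Set E} (hS : S.Nonempty) {t : ℝ} (ht : 0 ≤ t)
    {x : V → ℝ} :
    x ∈ t • G.subgraphPolytope S ↔ ∃ c : E → ℝ, (∀ e, 0 ≤ c e) ∧ (∀ e, e ∉ S → c e = 0) ∧
      ∑ e, c e = t ∧ ∑ e, c e • G.edgeVector e = x := by
  rcases ht.eq_or_lt with rfl | ht
  · rw [subgraphPolytope, Set.zero_smul_set ((hS.image _).mono (subset_convexHull ℝ _)),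
      Set.mem_zero]
    constructor
    · rintro rfl
      exact ⟨0, by simp⟩
    · rintro ⟨c, hc₀, -, hc₁, rfl⟩
      have := (Finset.sum_eq_zero_iff_of_nonneg fun e _ => hc₀ e).1 hc₁
      exact Finset.sum_eq_zero fun e he => by rw [this e he, zero_smul]
  · rw [Set.mem_smul_set_iff_inv_smul_mem₀ ht.ne', mem_subgraphPolytope_iff]
    constructor
    · rintro ⟨c, hc₀, hcS, hc₁, hcx⟩
      refine ⟨fun e => t * c e, fun e => mul_nonneg ht.le (hc₀ e), fun e he => by simp [hcS e he],
        by rw [← Finset.mul_sum, hc₁, mul_one], ?_⟩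
      simp only [mul_smul, ← Finset.smul_sum, hcx]
      rw [smul_inv_smul₀ ht.ne']
    · rintro ⟨c, hc₀, hcS, hc₁, rfl⟩
      refine ⟨fun e => t⁻¹ * c e, fun e => mul_nonneg (inv_nonneg.2 ht.le) (hc₀ e),
        fun e he => by simp [hcS e he], by rw [← Finset.mul_sum, hc₁, inv_mul_cancel₀ ht.ne'], ?_⟩
      simp only [mul_smul, ← Finset.smul_sum]

variable [Fintype V]

theorem IsSpanningTree.coord_nonneg {T : Set E} (hT : G.IsSpanningTree T) {x : V → ℝ}
    (hx : x ∈ G.subgraphPolytope T) (e : E) : 0 ≤ G.coord T e x := by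
  by_cases he : e ∈ T
  · obtain ⟨c, hc₀, hcT, -, rfl⟩ := mem_subgraphPolytope_iff.1 hx
    rw [hT.coord_sum_smul he hcT]
    exact hc₀ e
  · simp [coord_of_notMem he]

theorem IsSpanningTree.mem_subgraphPolytope {T : Set E} (hT : G.IsSpanningTree T) {x : V → ℝ}
    (hx : ∑ v, x v = 0) (hx₁ : ∑ e, G.coord T e x = 1) (hx₀ : ∀ e, 0 ≤ G.coord T e x) :
    x ∈ G.subgraphPolytope T :=
  mem_subgraphPolytope_iff.2 ⟨fun e => G.coord T e x, hx₀,
    fun e he => by simp [coord_of_notMem he], hx₁, hT.sum_coord_smul hx⟩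

/-- A point with positive coordinates is a relative interior point of the simplex of a tree. -/
theorem IsSemiBalanced.mem_intrinsicInterior (hG : G.IsSemiBalanced) {T : Set E}
    (hT : G.IsSpanningTree T) {x : V → ℝ} (hx : x ∈ G.subgraphPolytope T)
    (hpos : ∀ e ∈ T, 0 < G.coord T e x) :
    x ∈ intrinsicInterior ℝ (G.subgraphPolytope T) := by
  have haff : ∀ y ∈ affineSpan ℝ (G.subgraphPolytope T),
      ∑ v, y v = 0 ∧ ∑ e, G.coord T e y = 1 := by
    intro y hy
    refine affineSpan_induction (p := fun y => ∑ v, y v = 0 ∧ ∑ e, G.coord T e y = 1) hy ?_ ?_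
    · intro z hz
      obtain ⟨c, -, -, hc₁, rfl⟩ := mem_subgraphPolytope_iff.1 hz
      exact ⟨sum_sum_smul_edgeVector c, (hG.sum_coord_sum_smul hT c).trans hc₁⟩
    · rintro a u v w ⟨hu, hu'⟩ ⟨hv, hv'⟩ ⟨hw, hw'⟩
      simp only [vsub_eq_sub, vadd_eq_add, Pi.add_apply, Pi.smul_apply, Pi.sub_apply, map_add,
        map_smul, map_sub, Finset.sum_add_distrib, ← Finset.smul_sum, Finset.sum_sub_distrib,
        hu, hv, hw, hu', hv', hw']
      simp
  rw [_root_.mem_intrinsicInterior]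
  refine ⟨⟨x, subset_affineSpan ℝ _ hx⟩, ?_, rfl⟩
  rw [mem_interior]
  -- Inside the affine hull, both linear equations of the simplex hold automatically, so finitely
  -- many open inequalities suffice.
  refine ⟨⋂ e ∈ T, {y | 0 < G.coord T e y.1}, ?_, ?_, ?_⟩
  · intro y hy
    have hy' := Set.mem_iInter₂.1 hy
    obtain ⟨h₀, h₁⟩ := haff y.1 y.2
    refine hT.mem_subgraphPolytope h₀ h₁ fun e => ?_
    by_cases he : e ∈ T
    · exact (hy' e he).le
    · simp [coord_of_notMem he]
  · refine Set.Finite.isOpen_biInter (Set.toFinite T) fun e _ => ?_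
    exact isOpen_lt continuous_const ((continuous_coord T e).comp continuous_subtype_val)
  · exact Set.mem_iInter₂.2 hpos

theorem IsSpanningTree.linearIndependent {T : Set E} (hT : G.IsSpanningTree T) :
    LinearIndependent ℝ fun e : T => G.edgeVector e := by
  classical
  rw [Fintype.linearIndependent_iff]
  intro c hc e
  have h := congrArg (G.coord T e) hc
  rw [map_zero, map_sum, Finset.sum_eq_single e] at h
  · simpa [hT.coord_edgeVector_self e.2] using h
  · intro g _ hg
    rw [map_smul, coord_edgeVector_of_ne g.2 (fun h => hg (Subtype.ext h)), smul_zero]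
  · simp

/-- The dimension of the root polytope is one less than the number of edges of a spanning tree. -/
theorem IsSemiBalanced.polytopeDim_add_one [Nonempty E] (hG : G.IsSemiBalanced) {T : Set E}
    (hT : G.IsSpanningTree T) : polytopeDim G.rootPolytope + 1 = T.ncard := by
  classical
  have hspan : affineSpan ℝ (G.edgeVector '' Set.univ) =
      affineSpan ℝ (Set.range fun e : T => G.edgeVector e) := by
    refine le_antisymm (affineSpan_le.2 ?_) (affineSpan_mono ℝ ?_)
    · rintro _ ⟨g, -, rfl⟩
      have hoff : ∀ e ∉ Set.range ((↑) : T → E), G.coord T e (G.edgeVector g) = 0 :=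
        fun e he => by rw [coord_of_notMem (by simpa using he)]; rfl
      have h₁ : ∑ e : T, G.coord T e (G.edgeVector g) = 1 := by
        rw [← hG.sum_coord_edgeVector hT g]
        exact Fintype.sum_of_injective _ Subtype.val_injective _ _ hoff fun _ => rfl
      have h₂ : ∑ e : T, G.coord T e (G.edgeVector g) • G.edgeVector e = G.edgeVector g := by
        rw [← hT.sum_coord_smul (sum_edgeVector g)]
        conv_lhs => rw [hT.sum_coord_smul (sum_edgeVector g)]
        exact Fintype.sum_of_injective _ Subtype.val_injective _ _
          (fun e he => by rw [hoff e he, zero_smul]) fun _ => rfl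
      rw [← h₂, ← Finset.affineCombination_eq_linear_combination _
        (fun e : T => G.edgeVector e) _ h₁]
      exact affineCombination_mem_affineSpan h₁ _
    · rintro _ ⟨e, rfl⟩
      exact ⟨e, trivial, rfl⟩
  have hne : Nonempty T := by
    by_contra h
    obtain ⟨g⟩ := ‹Nonempty E›
    have h₁ := hG.sum_coord_edgeVector hT g
    rw [Finset.sum_eq_zero] at h₁
    · simp at h₁
    · exact fun e _ => by rw [coord_of_notMem fun he => h ⟨e, he⟩]; rfl
  have hfin := hT.linearIndependent.affineIndependent.finrank_vectorSpan_add_one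
  rw [polytopeDim, rootPolytope, subgraphPolytope, ← direction_affineSpan, affineSpan_convexHull,
    hspan, direction_affineSpan, hfin, ← Nat.card_eq_fintype_card, Nat.card_coe_set_eq]

end Polytopes

/-! ### Generic weights and small perturbations -/

section Weights

variable [Fintype E] [LinearOrder E]

/-- Take powers of two with the rank of the edge as exponent. -/
theorem exists_superincreasing_weights (E : Type*) [Fintype E] [LinearOrder E] :
    ∃ w : E → ℝ, (∀ e, 0 < w e) ∧ ∀ e, ∑ f with f < e, w f < w e := by
  set r : E → ℕ := fun e => (Finset.univ.filter fun f => f < e).card with hr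
  have hmono : StrictMono r := by
    intro a b hab
    refine Finset.card_lt_card
      (Finset.ssubset_iff_of_subset ?_ |>.2 ⟨a, by simpa using hab, by simp⟩)
    intro f hf
    simp only [Finset.mem_filter, Finset.mem_univ, true_and] at hf ⊢
    exact hf.trans hab
  refine ⟨fun e => (2 : ℝ) ^ r e, fun e => by positivity, fun e => ?_⟩
  have h := Nat.geomSum_lt (m := 2) (n := r e)
    (s := (Finset.univ.filter fun f => f < e).image r) le_rfl (by
      intro k hk
      obtain ⟨f, hf, rfl⟩ := Finset.mem_image.1 hk
      exact hmono (by simpa using hf))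
  rw [Finset.sum_image hmono.injective.injOn] at h
  have h' : ((∑ f with f < e, 2 ^ r f : ℕ) : ℝ) < (2 ^ r e : ℕ) := Nat.cast_lt.2 h
  simpa using h'

theorem sum_mul_pos_of_superincreasing {w : E → ℝ} (hw₀ : ∀ e, 0 < w e)
    (hw : ∀ e, ∑ f with f < e, w f < w e) {s : E → ℝ} {m : E} (hm : s m = 1)
    (hgt : ∀ g, m < g → s g = 0) (hge : ∀ g, -1 ≤ s g) : 0 < ∑ g, w g * s g := by
  have hle : ∑ g, ((if g = m then w g else 0) - if g < m then w g else 0) ≤ ∑ g, w g * s g := by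
    refine Finset.sum_le_sum fun g _ => ?_
    rcases lt_trichotomy g m with h | rfl | h
    · simp only [h.ne, if_false, h, if_true]
      nlinarith [hw₀ g, hge g]
    · simp [hm]
    · simp [h.ne', h.not_gt, hgt g h]
  have heq : ∑ g, ((if g = m then w g else 0) - if g < m then w g else 0) =
      w m - ∑ f with f < m, w f := by
    rw [Finset.sum_sub_distrib, Finset.sum_filter]
    simp
  have := hw m
  linarith

end Weights

/-- For small `ε` the sign of `a` prevails, and `b` decides only when `a = 0`; in particular the
perturbed value never vanishes. -/
theorem eventually_sign_add_mul (a : ℝ) {b : ℝ} (hb : b ≠ 0) :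
    ∀ᶠ ε in nhdsWithin (0 : ℝ) (Set.Ioi 0), (0 ≤ a + ε * b → 0 < a + ε * b) ∧
      (0 < a + ε * b ↔ 0 ≤ a ∧ (b < 0 → 0 < a)) := by
  have hcont : Filter.Tendsto (fun ε : ℝ => a + ε * b) (nhdsWithin 0 (Set.Ioi 0)) (nhds a) := by
    have : Continuous fun ε : ℝ => a + ε * b := by fun_prop
    simpa using this.continuousWithinAt.tendsto (x := (0 : ℝ)) (s := Set.Ioi 0)
  rcases lt_trichotomy a 0 with ha | rfl | ha
  · filter_upwards [hcont.eventually (gt_mem_nhds ha)] with ε hε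
    exact ⟨fun h => absurd h hε.not_ge, fun h => absurd h hε.not_gt, fun h => absurd h.1 ha.not_ge⟩
  · filter_upwards [self_mem_nhdsWithin] with ε hε
    have hε : 0 < ε := hε
    simp only [zero_add, le_refl, true_and, lt_irrefl, imp_false, not_lt, mul_pos_iff_of_pos_left hε,
      mul_nonneg_iff_of_pos_left hε]
    exact ⟨fun h => h.lt_of_ne' hb, fun h => h.le, fun h => h.lt_of_ne' hb⟩
  · filter_upwards [hcont.eventually (lt_mem_nhds ha)] with ε hε
    exact ⟨fun _ => hε, fun _ => ⟨ha.le, fun _ => ha⟩, fun _ => hε⟩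

/-! ### Half-open decomposition and lattice point count -/

section Decomposition

variable [Fintype V] [DecidableEq V] [Fintype E] [LinearOrder E] {G : EdgeDigraph V E}

/-- Only edges of the fundamental cut contribute, each with sign 1 or -1, and the weight of the
maximal one exceeds all the others together. -/
theorem IsSpanningTree.coord_generic {w : E → ℝ} (hw₀ : ∀ e, 0 < w e)
    (hw : ∀ e, ∑ f with f < e, w f < w e) {T : Set E} (hT : G.IsSpanningTree T) {e : E}
    (he : e ∈ T) :
    G.coord T e (∑ g, w g • G.edgeVector g) ≠ 0 ∧
      (G.coord T e (∑ g, w g • G.edgeVector g) < 0 ↔ G.IsInternallySemiPassive T e) := by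
  obtain ⟨m, hm, hmax⟩ := (Set.toFinite (G.fundamentalCut T e)).exists_maximal
    ⟨e, hT.not_joined_diff he⟩
  have hgreatest : IsGreatest (G.fundamentalCut T e) m :=
    ⟨hm, fun g hg => (le_total g m).elim id fun h => hmax hg h⟩
  have hpassive : G.IsInternallySemiPassive T e ↔ ¬ G.StandsParallel T e m :=
    ⟨fun ⟨_, f, hf, hfp⟩ => hf.unique hgreatest ▸ hfp, fun h => ⟨he, m, hgreatest, h⟩⟩
  have hgt : ∀ g, m < g → G.coord T e (G.edgeVector g) = 0 := fun g hg =>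
    coord_edgeVector_of_joined (by_contra fun h => (hgreatest.2 h).not_gt hg)
  have hbound : ∀ g, -1 ≤ G.coord T e (G.edgeVector g) ∧ G.coord T e (G.edgeVector g) ≤ 1 := by
    intro g
    by_cases hg : G.Joined (T \ {e}) (G.tail g) (G.head g)
    · simp [coord_edgeVector_of_joined hg]
    · by_cases hp : G.StandsParallel T e g
      · simp [coord_edgeVector_of_parallel he hg hp]
      · simp [hT.coord_edgeVector_of_not_parallel he hg hp]
  have hsum : G.coord T e (∑ g, w g • G.edgeVector g) =
      ∑ g, w g * G.coord T e (G.edgeVector g) := by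
    simp only [map_sum, map_smul, smul_eq_mul]
  rw [hsum, hpassive]
  by_cases hp : G.StandsParallel T e m
  · have h := sum_mul_pos_of_superincreasing hw₀ hw (coord_edgeVector_of_parallel he hm hp) hgt
      fun g => (hbound g).1
    exact ⟨h.ne', fun h' => absurd h' h.not_gt, fun h' => absurd hp h'⟩
  · have h := sum_mul_pos_of_superincreasing hw₀ hw
      (s := fun g => -G.coord T e (G.edgeVector g))
      (neg_eq_iff_eq_neg.2 (hT.coord_edgeVector_of_not_parallel he hm hp))
      (fun g hg => by simp [hgt g hg]) fun g => by linarith [(hbound g).2]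
    simp only [mul_neg, Finset.sum_neg_distrib, Left.neg_pos_iff] at h
    exact ⟨h.ne, fun _ => hp, fun _ => h⟩

/-- The cone over the simplex of `T` without the facets opposite to internally semi-passive
edges. -/
def halfOpenCone (G : EdgeDigraph V E) (T : Set E) : Set (V → ℝ) :=
  {x | ∀ e ∈ T, 0 ≤ G.coord T e x ∧ (G.IsInternallySemiPassive T e → 0 < G.coord T e x)}

/-- Covering gives existence, since the perturbed point lies on no facet of a simplex containing it;
disjointness of relative interiors gives uniqueness. -/
theorem IsDissectingTreeSet.existsUnique_halfOpenCone [Nonempty E] (hG : G.IsSemiBalanced)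
    {𝒯 : Set (Set E)} (h𝒯 : G.IsDissectingTreeSet 𝒯) {t : ℝ} (ht : 0 ≤ t) {x : V → ℝ}
    (hx : x ∈ t • G.rootPolytope) : ∃! T, T ∈ 𝒯 ∧ x ∈ G.halfOpenCone T := by
  obtain ⟨w, hw₀, hw⟩ := exists_superincreasing_weights E
  set p := ∑ g, w g • G.edgeVector g with hp
  -- Finiteness allows a single `ε` for all trees and edges.
  have hev : ∀ᶠ ε in nhdsWithin (0 : ℝ) (Set.Ioi 0), ∀ T ∈ 𝒯, ∀ e ∈ T,
      (0 ≤ G.coord T e x + ε * G.coord T e p → 0 < G.coord T e x + ε * G.coord T e p) ∧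
        (0 < G.coord T e x + ε * G.coord T e p ↔
          0 ≤ G.coord T e x ∧ (G.coord T e p < 0 → 0 < G.coord T e x)) := by
    rw [Filter.eventually_all_finite (Set.toFinite 𝒯)]
    intro T hT
    rw [Filter.eventually_all_finite (Set.toFinite T)]
    intro e he
    exact eventually_sign_add_mul _ ((h𝒯.isSpanningTree T hT).coord_generic hw₀ hw he).1
  obtain ⟨ε, hε, hε₀⟩ := (hev.and self_mem_nhdsWithin).exists
  have hε₀ : 0 < ε := hε₀
  obtain ⟨c, hc₀, -, hct, rfl⟩ := (mem_smul_subgraphPolytope_iff Set.univ_nonempty ht).1 hx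
  set x := ∑ e, c e • G.edgeVector e
  have hW : 0 < ∑ e, w e := Finset.sum_pos (fun e _ => hw₀ e) Finset.univ_nonempty
  set s := t + ε * ∑ e, w e with hs
  have hs₀ : 0 < s := by positivity
  -- Dividing by the total weight `s` returns the perturbed point to the polytope; `s` is positive
  -- even for `t = 0`.
  set y := s⁻¹ • (x + ε • p) with hy
  have hyG : y ∈ G.rootPolytope := by
    refine mem_subgraphPolytope_iff.2 ⟨fun e => s⁻¹ * (c e + ε * w e), fun e => ?_, by simp, ?_, ?_⟩
    · have := hc₀ e
      have := hw₀ e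
      positivity
    · rw [← Finset.mul_sum, Finset.sum_add_distrib, ← Finset.mul_sum, hct, ← hs,
        inv_mul_cancel₀ hs₀.ne']
    · simp only [mul_smul, add_smul, ← Finset.smul_sum, Finset.sum_add_distrib]
      rfl
  have hcoord : ∀ T e, G.coord T e y = s⁻¹ * (G.coord T e x + ε * G.coord T e p) := by
    intro T e
    rw [hy, map_smul, map_add, map_smul, smul_eq_mul, smul_eq_mul]
  have hcone : ∀ T ∈ 𝒯, (x ∈ G.halfOpenCone T ↔ ∀ e ∈ T, 0 < G.coord T e y) := by
    intro T hT
    refine forall₂_congr fun e he => ?_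
    rw [hcoord, mul_pos_iff_of_pos_left (inv_pos.2 hs₀), (hε T hT e he).2,
      ((h𝒯.isSpanningTree T hT).coord_generic hw₀ hw he).2]
  have hmem : ∀ T ∈ 𝒯, (∀ e ∈ T, 0 < G.coord T e y) → y ∈ G.subgraphPolytope T := by
    intro T hT hpos
    obtain ⟨d, -, -, hd₁, hdy⟩ := mem_subgraphPolytope_iff.1 hyG
    refine (h𝒯.isSpanningTree T hT).mem_subgraphPolytope ?_ ?_ fun e => ?_
    · rw [← hdy]
      exact sum_sum_smul_edgeVector d
    · rw [← hdy, hG.sum_coord_sum_smul (h𝒯.isSpanningTree T hT), hd₁]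
    · by_cases he : e ∈ T
      · exact (hpos e he).le
      · simp [coord_of_notMem he]
  obtain ⟨T, hT, hyT⟩ := Set.mem_iUnion₂.1 (h𝒯.cover.symm ▸ hyG)
  have hpos : ∀ e ∈ T, 0 < G.coord T e y := fun e he => by
    have h := (h𝒯.isSpanningTree T hT).coord_nonneg hyT e
    rw [hcoord] at h ⊢
    rw [mul_nonneg_iff_of_pos_left (inv_pos.2 hs₀)] at h
    exact mul_pos (inv_pos.2 hs₀) ((hε T hT e he).1 h)
  refine ⟨T, ⟨hT, (hcone T hT).2 hpos⟩, ?_⟩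
  rintro T' ⟨hT', hxT'⟩
  by_contra hne
  have hpos' := (hcone T' hT').1 hxT'
  exact Set.disjoint_left.1 (h𝒯.interior_disjoint T' hT' T hT hne)
    (hG.mem_intrinsicInterior (h𝒯.isSpanningTree T' hT') (hmem T' hT' hpos') hpos')
    (hG.mem_intrinsicInterior (h𝒯.isSpanningTree T hT) hyT hpos)

/-- The coordinates of the generic point have positive sum, so one of them is positive and its edge
is not semi-passive. -/
theorem IsSemiBalanced.internalSemiPassivity_le [Nonempty E] (hG : G.IsSemiBalanced) {T : Set E}
    (hT : G.IsSpanningTree T) : G.internalSemiPassivity T ≤ polytopeDim G.rootPolytope := by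
  obtain ⟨w, hw₀, hw⟩ := exists_superincreasing_weights E
  have hpos : 0 < ∑ e, G.coord T e (∑ g, w g • G.edgeVector g) := by
    rw [hG.sum_coord_sum_smul hT]
    exact Finset.sum_pos (fun e _ => hw₀ e) Finset.univ_nonempty
  obtain ⟨e, -, he⟩ := Finset.exists_lt_of_sum_lt (s := Finset.univ) (f := fun _ : E => (0 : ℝ))
    (Finset.sum_const_zero.trans_lt hpos)
  have heT : e ∈ T := by
    by_contra h
    simp [coord_of_notMem h] at he
  rw [← Nat.lt_succ_iff, Nat.succ_eq_add_one, hG.polytopeDim_add_one hT]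
  refine Set.ncard_lt_ncard ⟨fun f hf => hf.1, fun h => ?_⟩ (Set.toFinite T)
  exact he.not_gt ((hT.coord_generic hw₀ hw heT).2.2 (h heT))

/-- Lattice points of a half-open simplex, counted by stars and bars. -/
theorem IsSemiBalanced.exists_finset_halfOpenCone [Nonempty E] (hG : G.IsSemiBalanced) {T : Set E}
    (hT : G.IsSpanningTree T) (t : ℕ) : ∃ F : Finset (V → ℝ),
      (∀ x, x ∈ F ↔ (x ∈ ((t : ℝ) • G.rootPolytope) ∩ {x | ∀ u, ∃ z : ℤ, x u = z}) ∧
        x ∈ G.halfOpenCone T) ∧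
      F.card = (t + polytopeDim G.rootPolytope - G.internalSemiPassivity T).choose
        (polytopeDim G.rootPolytope) := by
  classical
  set d := polytopeDim G.rootPolytope with hd
  set k := G.internalSemiPassivity T with hk
  have hkd : k ≤ d := hG.internalSemiPassivity_le hT
  set P : Finset E := {e | G.IsInternallySemiPassive T e}.toFinset with hP
  have hPk : P.card = k := by rw [hk, internalSemiPassivity, Set.ncard_eq_toFinset_card']
  have hmemP : ∀ e, e ∈ P ↔ G.IsInternallySemiPassive T e := fun e => by simp [hP]
  have hTd : T.toFinset.card = d + 1 := by
    rw [hd, hG.polytopeDim_add_one hT, Set.ncard_eq_toFinset_card']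
  -- A coordinate at a semi-passive edge is a positive integer; subtracting `χ` leaves arbitrary
  -- naturals on `T` with sum `t - k`.
  set χ : E → ℕ := fun e => if e ∈ P then 1 else 0 with hχ
  have hχT : ∀ e ∉ T, χ e = 0 := fun e he =>
    if_neg fun h => he ((hmemP e).1 h).1
  have hχk : ∑ e, χ e = k := by simp [hχ, hPk]
  set φ : (E →₀ ℕ) → V → ℝ := fun a => ∑ e, ((a e + χ e : ℕ) : ℝ) • G.edgeVector e with hφ
  have hcoord : ∀ a : E →₀ ℕ, a.support ⊆ T.toFinset → ∀ e ∈ T,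
      G.coord T e (φ a) = (a e + χ e : ℕ) := by
    intro a ha e he
    refine hT.coord_sum_smul he (c := fun e => ((a e + χ e : ℕ) : ℝ)) fun g hg => ?_
    have : a g = 0 := Finsupp.notMem_support_iff.1 fun h => hg (Set.mem_toFinset.1 (ha h))
    simp [this, hχT g hg]
  have hsumT : ∀ a : E →₀ ℕ, a.support ⊆ T.toFinset → ∑ e ∈ T.toFinset, a e = ∑ e, a e :=
    fun a ha => Finset.sum_subset (Finset.subset_univ _) fun e _ he =>
      Finsupp.notMem_support_iff.1 fun h => he (ha h)
  have hinj : Set.InjOn φ {a | a.support ⊆ T.toFinset} := by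
    intro a ha b hb hab
    ext e
    by_cases he : e ∈ T
    · have h := (hcoord a ha e he).symm.trans ((congrArg _ hab).trans (hcoord b hb e he))
      exact Nat.add_right_cancel (Nat.cast_injective h)
    · rw [Finsupp.notMem_support_iff.1 fun h => he (Set.mem_toFinset.1 (ha h)),
        Finsupp.notMem_support_iff.1 fun h => he (Set.mem_toFinset.1 (hb h))]
  have hchar : ∀ x, ((x ∈ ((t : ℝ) • G.rootPolytope) ∩ {x | ∀ u, ∃ z : ℤ, x u = z}) ∧
      x ∈ G.halfOpenCone T) ↔
        ∃ a : E →₀ ℕ, (∑ e ∈ T.toFinset, a e + k = t ∧ a.support ⊆ T.toFinset) ∧ φ a = x := by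
    intro x
    constructor
    · rintro ⟨⟨hxt, hxz⟩, hxT⟩
      obtain ⟨c, -, -, hct, hcx⟩ :=
        (mem_smul_subgraphPolytope_iff Set.univ_nonempty t.cast_nonneg).1 hxt
      have hnat : ∀ e, ∃ n : ℕ, G.coord T e x = (n + χ e : ℕ) := by
        intro e
        by_cases he : e ∈ T
        · obtain ⟨z, hz⟩ := exists_int_coord (G := G) T e hxz
          obtain ⟨h₀, h₁⟩ := hxT e he
          rw [hz] at h₀ h₁ ⊢
          have hz' : (χ e : ℤ) ≤ z := by
            by_cases hep : e ∈ P
            · have := h₁ ((hmemP e).1 hep)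
              simp only [hχ, hep, if_true]
              exact_mod_cast this
            · simp only [hχ, hep, if_false]
              exact_mod_cast h₀
          refine ⟨(z - χ e).toNat, ?_⟩
          have : (((z - χ e).toNat + χ e : ℕ) : ℤ) = z := by
            push_cast
            omega
          exact_mod_cast this.symm
        · exact ⟨0, by simp [coord_of_notMem he, hχT e he]⟩
      choose n hn using hnat
      have hsupp : (Finsupp.equivFunOnFinite.symm n).support ⊆ T.toFinset := by
        intro e he
        rw [Set.mem_toFinset]
        by_contra heT
        have := hn e
        rw [coord_of_notMem heT, hχT e heT] at this
        have : n e = 0 := by simpa using this.symm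
        simp [this] at he
      refine ⟨Finsupp.equivFunOnFinite.symm n, ⟨?_, hsupp⟩, ?_⟩
      · rw [hsumT _ hsupp, ← hχk, ← Finset.sum_add_distrib]
        have h := hG.sum_coord_sum_smul hT c
        rw [hcx, hct] at h
        simp only [hn] at h
        simp only [Finsupp.equivFunOnFinite_symm_apply_apply]
        exact_mod_cast h
      · have hx₀ : ∑ v, x v = 0 := by
          rw [← hcx]
          exact sum_sum_smul_edgeVector c
        rw [← hT.sum_coord_smul hx₀]
        simp only [hφ, hn, Finsupp.equivFunOnFinite_symm_apply_apply]
    · rintro ⟨a, ⟨hat, ha⟩, rfl⟩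
      refine ⟨⟨?_, fun u => ?_⟩, fun e he => ?_⟩
      · refine (mem_smul_subgraphPolytope_iff Set.univ_nonempty t.cast_nonneg).2
          ⟨_, fun e => Nat.cast_nonneg _, by simp, ?_, rfl⟩
        rw [← hat, ← hχk, hsumT a ha, ← Finset.sum_add_distrib]
        push_cast
        rfl
      · refine ⟨∑ e, ((a e + χ e : ℕ) : ℤ) *
          ((Pi.single (G.head e) 1 : V → ℤ) u - (Pi.single (G.tail e) 1 : V → ℤ) u), ?_⟩
        simp [hφ, edgeVector, Pi.single_apply]
      · rw [hcoord a ha e he]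
        refine ⟨Nat.cast_nonneg _, fun h => ?_⟩
        have : χ e = 1 := if_pos ((hmemP e).2 h)
        rw [this]
        positivity
  rcases lt_or_ge t k with htk | hkt
  · refine ⟨∅, fun x => ?_, ?_⟩
    · rw [hchar]
      simp only [Finset.notMem_empty, false_iff]
      rintro ⟨a, ⟨hat, -⟩, -⟩
      omega
    · rw [Nat.choose_eq_zero_of_lt (by omega), Finset.card_empty]
  · refine ⟨(T.toFinset.finsuppAntidiag (t - k)).image φ, fun x => ?_, ?_⟩
    · rw [hchar, Finset.mem_image]
      refine exists_congr fun a => and_congr_left fun _ => ?_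
      rw [Finset.mem_finsuppAntidiag]
      exact and_congr_left fun _ =>
        ⟨fun h => (congrArg (· + k) h).trans (Nat.sub_add_cancel hkt), Nat.eq_sub_of_add_eq⟩
    -- Distributing `t - k` units among the `d + 1` edges of `T`.
    · rw [Finset.card_image_of_injOn, Finset.card_finsuppAntidiag_nat_eq_choose, hTd,
        show d + 1 + (t - k) - 1 = (t - k) + d by omega, show t + d - k = (t - k) + d by omega,
        Nat.choose_symm_add]
      exact hinj.mono fun a ha => (Finset.mem_finsuppAntidiag.1 ha).2

theorem IsDissectingTreeSet.isHStarVector [Nonempty E] (hG : G.IsSemiBalanced)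
    {𝒯 : Set (Set E)} (h𝒯 : G.IsDissectingTreeSet 𝒯) :
    IsHStarVector G.rootPolytope fun i => ({T ∈ 𝒯 | G.internalSemiPassivity T = i}.ncard : ℚ) := by
  classical
  set d := polytopeDim G.rootPolytope with hd
  have hle : ∀ T ∈ 𝒯, G.internalSemiPassivity T ≤ d := fun T hT =>
    hG.internalSemiPassivity_le (h𝒯.isSpanningTree T hT)
  set A : Finset (Set E) := (Set.toFinite 𝒯).toFinset with hA
  have hmemA : ∀ T, T ∈ A ↔ T ∈ 𝒯 := fun T => Set.Finite.mem_toFinset _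
  have hcard : ∀ i, {T ∈ 𝒯 | G.internalSemiPassivity T = i}.ncard =
      (A.filter fun T => G.internalSemiPassivity T = i).card := by
    intro i
    rw [← Set.ncard_coe_finset]
    congr 1
    ext T
    simp [hmemA]
  refine ⟨fun t => ?_, fun k hk => ?_⟩
  · have hF : ∀ T : Set E, ∃ F : Finset (V → ℝ), T ∈ 𝒯 →
        (∀ x, x ∈ F ↔ (x ∈ ((t : ℝ) • G.rootPolytope) ∩ {x | ∀ u, ∃ z : ℤ, x u = z}) ∧
          x ∈ G.halfOpenCone T) ∧ F.card = (t + d - G.internalSemiPassivity T).choose d := by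
      intro T
      by_cases hT : T ∈ 𝒯
      · obtain ⟨F, hF⟩ := hG.exists_finset_halfOpenCone (h𝒯.isSpanningTree T hT) t
        exact ⟨F, fun _ => hF⟩
      · exact ⟨∅, fun h => absurd h hT⟩
    choose F hF using hF
    have hunion : ((t : ℝ) • G.rootPolytope) ∩ {x | ∀ u, ∃ z : ℤ, x u = z} = A.biUnion F := by
      ext x
      simp only [Finset.coe_biUnion, Set.mem_iUnion, Finset.mem_coe, exists_prop]
      constructor
      · intro hx
        obtain ⟨T, ⟨hT, hxT⟩, -⟩ := h𝒯.existsUnique_halfOpenCone hG t.cast_nonneg hx.1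
        exact ⟨T, (hmemA T).2 hT, ((hF T hT).1 x).2 ⟨hx, hxT⟩⟩
      · rintro ⟨T, hT, hx⟩
        exact (((hF T ((hmemA T).1 hT)).1 x).1 hx).1
    have hdisj : (A : Set (Set E)).PairwiseDisjoint F := by
      intro T hT T' hT' hne
      refine Finset.disjoint_left.2 fun x hx hx' => hne ?_
      have hT := (hmemA T).1 hT
      have hT' := (hmemA T').1 hT'
      have h := ((hF T hT).1 x).1 hx
      have h' := ((hF T' hT').1 x).1 hx'
      exact (h𝒯.existsUnique_halfOpenCone hG t.cast_nonneg h.1.1).unique ⟨hT, h.2⟩ ⟨hT', h'.2⟩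
    rw [latticeCount, hunion, Set.ncard_coe_finset, Finset.card_biUnion hdisj,
      Finset.sum_congr rfl fun T hT => (hF T ((hmemA T).1 hT)).2,
      -- Trees are grouped by semi-passivity, which is at most `d`, so the range misses none.
      ← Finset.sum_fiberwise_of_maps_to (s := A) (t := Finset.range (d + 1))
        (g := G.internalSemiPassivity) fun T hT =>
          Finset.mem_range.2 (Nat.lt_succ_of_le (hle T ((hmemA T).1 hT)))]
    push_cast
    refine Finset.sum_congr rfl fun k _ => ?_
    rw [hcard, Finset.sum_congr rfl fun T hT => by rw [(Finset.mem_filter.1 hT).2]]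
    rw [Finset.sum_const, nsmul_eq_mul]
  · have : {T ∈ 𝒯 | G.internalSemiPassivity T = k} = ∅ :=
      Set.eq_empty_of_forall_notMem fun T hT => (hle T hT.1).not_gt (hT.2 ▸ hk)
    simp [this]

end Decomposition

end EdgeDigraph

theorem mainTheorem3 {V E : Type*} [Fintype V] [DecidableEq V] [Fintype E] [Nonempty E]
    [LinearOrder E] (G : EdgeDigraph V E) (hG : G.IsSemiBalanced)
    (𝒯 : Set (Set E)) (h𝒯 : G.IsDissectingTreeSet 𝒯) :
    IsHStarVector G.rootPolytope (hStarVector G.rootPolytope) ∧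
      ∀ i : ℕ, hStarVector G.rootPolytope i =
        ({T ∈ 𝒯 | G.internalSemiPassivity T = i}.ncard : ℚ) := by
  have h := h𝒯.isHStarVector hG
  have h' : IsHStarVector G.rootPolytope (hStarVector G.rootPolytope) :=
    Classical.epsilon_spec (p := IsHStarVector G.rootPolytope) ⟨_, h⟩
  exact ⟨h', fun i => congrFun (h'.unique h) i⟩
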